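/- Let $K \subset \mathbb{R}^2$ be a compact connected set with $\mathcal{H}^1(K) < \infty$, where $\mathcal{H}^1$ denotes the one-dimensional Hausdorff measure on the Euclidean plane. Let $C$ be the convex hull of $K$, and let $\partial C$ be its topological boundary in $\mathbb{R}^2$. Then $$\mathcal{H}^1(\partial C) \le 2\,\mathcal{H}^1(K).$$ -/

import Mathlib

open scoped MeasureTheory

open MeasureTheory

/-! Crofton's formula proves the bound for polygons spanned by finitely many points of `K`, but
applying it to `K` itself would require integral geometry of general continua. A linear-programming
duality argument replaces this.

Each oriented line splits the finite point set. Weight a subset by the normalized measure of the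
lines cutting it off from a root. For each pair of points, the weights separating it then add up to
exactly its distance. Any such packing has total weight at most the length of a connected set
through the points: uncrossing makes the weighted family laminar (`exists_laminar`), and then each
set carries an annular moat of width its weight. These moats are pairwise disjoint, and `K` must
traverse each of them.

An oriented line crosses at most one positively oriented edge of a convex polygon upwards
(`IsEdge.eq_of_mem_upCrossing`). The perimeter is therefore bounded by the measure of the lines
separating the points, which is twice the total weight after normalization; hence the factor 2.

The general case follows by enclosing the hull in slightly dilated inscribed polygons and using
monotonicity of perimeter. If the hull has empty interior, `K` is collinear and equals its hull. -/

/-- A nonnegative weighting of the subsets of `ι` avoiding the root `r` such that, for every pair of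
points, the total weight of the subsets separating the pair is at most the distance. -/
structure IsMoatPacking {ι X : Type*} [Fintype ι] [DecidableEq ι] [MetricSpace X]
    (x : ι → X) (r : ι) (y : Finset ι → ℝ) : Prop where
  nonneg : ∀ S, 0 ≤ y S
  root : ∀ S, r ∈ S → y S = 0
  empty : y ∅ = 0
  sep_le : ∀ i j, ∑ S, (if (i ∈ S ↔ j ∈ S) then 0 else y S) ≤ dist (x i) (x j)

/-! ### Moat packings, uncrossing, and the lower bound for length -/

namespace IsMoatPacking

variable {ι X : Type*} [Fintype ι] [DecidableEq ι] [MetricSpace X]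
  {x : ι → X} {r : ι} {y : Finset ι → ℝ}

/-- Total weight of the proper subsets of `S` containing `i`. -/
def radius (y : Finset ι → ℝ) (S : Finset ι) (i : ι) : ℝ :=
  ∑ T, if i ∈ T ∧ T ⊂ S then y T else 0

/-- The region at distance between `radius y S i` and `radius y S i + y S` from the points `x i`,
`i ∈ S`. -/
def moat (x : ι → X) (y : Finset ι → ℝ) (S : Finset ι) : Set X :=
  {z | (∀ i ∈ S, radius y S i < dist z (x i)) ∧ ∃ i ∈ S, dist z (x i) < radius y S i + y S}

theorem isOpen_moat (S : Finset ι) : IsOpen (moat x y S) := by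
  have : moat x y S = (⋂ i ∈ S, {z | radius y S i < dist z (x i)}) ∩
      ⋃ i ∈ S, {z | dist z (x i) < radius y S i + y S} := by
    ext z; simp [moat]
  rw [this]
  refine IsOpen.inter (isOpen_biInter_finset fun i _ => ?_) (isOpen_biUnion fun i _ => ?_)
  · exact isOpen_lt (by fun_prop) (by fun_prop)
  · exact isOpen_lt (by fun_prop) (by fun_prop)

theorem radius_add (S : Finset ι) {i : ι} (hi : i ∈ S) :
    radius y S i + y S = ∑ T, if i ∈ T ∧ T ⊆ S then y T else 0 := by
  have : y S = ∑ T, if T = S then y T else 0 := by simp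
  rw [this, radius, ← Finset.sum_add_distrib]
  refine Finset.sum_congr rfl fun T _ => ?_
  by_cases hT : T = S
  · subst hT; simp [hi]
  · have : T ⊂ S ↔ T ⊆ S := ⟨fun h => h.1, fun h => h.ssubset_of_ne hT⟩
    simp [hT, this]

theorem radius_nonneg (h : IsMoatPacking x r y) (S : Finset ι) (i : ι) : 0 ≤ radius y S i :=
  Finset.sum_nonneg fun T _ => by split_ifs <;> simp [h.nonneg]

/-- Every set counted in the outer radius of `S` is also counted in the inner radius of `T`, so the
moat of `T` starts outside that of `S`. -/
theorem radius_add_le_radius (h : IsMoatPacking x r y) {S T : Finset ι} (hST : S ⊂ T) {i : ι}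
    (hi : i ∈ S) : radius y S i + y S ≤ radius y T i := by
  rw [radius_add S hi]
  refine Finset.sum_le_sum fun U _ => ?_
  by_cases hU : i ∈ U ∧ U ⊆ S
  · simp [hU, hU.2.trans_ssubset hST]
  · simp only [hU, if_false]; split_ifs <;> simp [h.nonneg]

theorem disjoint_moat_of_ssubset (h : IsMoatPacking x r y) {S T : Finset ι} (hST : S ⊂ T) :
    Disjoint (moat x y S) (moat x y T) := by
  rw [Set.disjoint_left]
  rintro z ⟨-, i, hi, hz⟩ ⟨hz', -⟩
  have := hz' i (hST.1 hi)
  have := h.radius_add_le_radius hST hi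
  linarith

/-- A subset of `S` containing `i` and a subset of `T` containing `j` both separate `i` from `j`,
and no set is of both kinds. The two outer radii therefore add up to at most the distance, and the
balls cannot overlap. -/
theorem disjoint_moat_of_disjoint (h : IsMoatPacking x r y) {S T : Finset ι} (hST : Disjoint S T) :
    Disjoint (moat x y S) (moat x y T) := by
  rw [Set.disjoint_left]
  rintro z ⟨-, i, hi, hzi⟩ ⟨-, j, hj, hzj⟩
  rw [radius_add S hi] at hzi
  rw [radius_add T hj] at hzj
  have h1 := h.sep_le i j
  have h2 : (∑ U, if i ∈ U ∧ U ⊆ S then y U else 0) + (∑ U, if j ∈ U ∧ U ⊆ T then y U else 0) ≤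
      ∑ U, (if (i ∈ U ↔ j ∈ U) then 0 else y U) := by
    rw [← Finset.sum_add_distrib]
    refine Finset.sum_le_sum fun U _ => ?_
    have hjS : j ∉ S := Finset.disjoint_right.1 hST hj
    have hiT : i ∉ T := Finset.disjoint_left.1 hST hi
    have h0 := h.nonneg U
    by_cases h1 : i ∈ U ∧ U ⊆ S
    · have : j ∉ U := fun hh => hjS (h1.2 hh)
      simp [h1, this]
    · by_cases h2 : j ∈ U ∧ U ⊆ T
      · have : i ∉ U := fun hh => hiT (h2.2 hh)
        simp [h2, this]
      · simp only [h1, h2, if_false]; split_ifs <;> simp [h0]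
  have h3 := dist_triangle_left (x i) (x j) z
  linarith

/-- The least excess of the distance over the inner radius is 1-Lipschitz, nonpositive at the points
of `S` and at least `y S` at the root. On the connected set `K` it takes every value in between, and
the values in `(0, y S)` are taken in the moat. -/
theorem le_hausdorffMeasure_moat [MeasurableSpace X] [BorelSpace X] (h : IsMoatPacking x r y)
    {K : Set X} (hK : IsPreconnected K) (hx : ∀ i, x i ∈ K) (S : Finset ι) :
    ENNReal.ofReal (y S) ≤ μH[1] (K ∩ moat x y S) := by
  rcases S.eq_empty_or_nonempty with rfl | hS
  · simp [h.empty]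
  by_cases hr : r ∈ S
  · simp [h.root S hr]
  let f : X → ℝ := fun z => S.inf' hS fun i => dist z (x i) - radius y S i
  have hf : LipschitzWith 1 f := by
    refine LipschitzWith.of_le_add fun a b => ?_
    obtain ⟨i, hi, hb⟩ := S.exists_mem_eq_inf' hS fun i => dist b (x i) - radius y S i
    calc f a ≤ dist a (x i) - radius y S i := Finset.inf'_le _ hi
      _ ≤ f b + dist a b := by
        simp only [f, hb]; linarith [dist_triangle a b (x i)]
  obtain ⟨i, hi⟩ := hS
  have h0 : f (x i) ≤ 0 := by
    refine (Finset.inf'_le _ hi).trans ?_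
    simp [h.radius_nonneg]
  have h1 : y S ≤ f (x r) := by
    refine Finset.le_inf' _ _ fun j hj => ?_
    have := h.sep_le r j
    have h2 : radius y S j + y S ≤ ∑ U, (if (r ∈ U ↔ j ∈ U) then 0 else y U) := by
      rw [radius_add S hj]
      refine Finset.sum_le_sum fun U _ => ?_
      by_cases h1 : j ∈ U ∧ U ⊆ S
      · have : r ∉ U := fun hh => hr (h1.2 hh)
        simp [h1, this]
      · simp only [h1, if_false]; split_ifs <;> simp [h.nonneg]
    linarith
  have hsub : Set.Ioo 0 (y S) ⊆ f '' (K ∩ moat x y S) := by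
    intro t ht
    obtain ⟨z, hz, rfl⟩ := hK.intermediate_value (hx i) (hx r) hf.continuous.continuousOn
      ⟨h0.trans ht.1.le, ht.2.le.trans h1⟩
    refine ⟨z, ⟨hz, ?_, ?_⟩, rfl⟩
    · intro j hj
      have : f z ≤ _ := Finset.inf'_le (fun i => dist z (x i) - radius y S i) hj
      linarith [ht.1]
    · obtain ⟨j, hj, hjz⟩ := S.exists_mem_eq_inf' ⟨i, hi⟩ fun i => dist z (x i) - radius y S i
      refine ⟨j, hj, ?_⟩
      have : f z = _ := hjz
      linarith [ht.2]
  calc ENNReal.ofReal (y S) = μH[1] (Set.Ioo 0 (y S)) := by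
        rw [MeasureTheory.hausdorffMeasure_real, Real.volume_Ioo, sub_zero]
    _ ≤ μH[1] (f '' (K ∩ moat x y S)) := MeasureTheory.measure_mono hsub
    _ ≤ μH[1] (K ∩ moat x y S) := by
        simpa using hf.hausdorffMeasure_image_le zero_le_one (K ∩ moat x y S)

theorem sum_le_hausdorffMeasure_of_laminar [MeasurableSpace X] [BorelSpace X]
    (h : IsMoatPacking x r y) {K : Set X} (hK : IsPreconnected K) (hKm : MeasurableSet K)
    (hx : ∀ i, x i ∈ K)
    (hlam : ∀ S T, y S ≠ 0 → y T ≠ 0 → S ⊆ T ∨ T ⊆ S ∨ Disjoint S T) :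
    ENNReal.ofReal (∑ S, y S) ≤ μH[1] K := by
  classical
  have hsum : ∑ S, y S = ∑ S with y S ≠ 0, y S := (Finset.sum_filter_ne_zero _).symm
  rw [hsum, ENNReal.ofReal_sum_of_nonneg fun S _ => h.nonneg S]
  calc _ ≤ ∑ S with y S ≠ 0, μH[1] (K ∩ moat x y S) :=
        Finset.sum_le_sum fun S _ => h.le_hausdorffMeasure_moat hK hx S
    _ = μH[1] (⋃ S ∈ Finset.univ.filter (fun S => y S ≠ 0), K ∩ moat x y S) := by
        refine (MeasureTheory.measure_biUnion_finset ?_ fun S _ =>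
          hKm.inter (isOpen_moat S).measurableSet).symm
        intro S hS T hT hST
        refine Disjoint.mono Set.inter_subset_right Set.inter_subset_right ?_
        simp only [Finset.coe_filter, Finset.mem_univ, true_and, Set.mem_ofPred_eq] at hS hT
        rcases hlam S T hS hT with h1 | h1 | h1
        · exact h.disjoint_moat_of_ssubset (h1.ssubset_of_ne hST)
        · exact (h.disjoint_moat_of_ssubset (h1.ssubset_of_ne hST.symm)).symm
        · exact h.disjoint_moat_of_disjoint h1
    _ ≤ μH[1] K := MeasureTheory.measure_mono (by simp)

theorem le_dist (h : IsMoatPacking x r y) {S : Finset ι} {i : ι} (hi : i ∈ S) :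
    y S ≤ dist (x r) (x i) := by
  by_cases hr : r ∈ S
  · simp [h.root S hr]
  refine le_trans ?_ (h.sep_le r i)
  have := Finset.single_le_sum (f := fun S => if (r ∈ S ↔ i ∈ S) then 0 else y S)
    (fun T _ => by split_ifs <;> simp [h.nonneg]) (Finset.mem_univ S)
  simpa [hr, hi] using this

/-- The distance constraints bound the weight of every nonempty set. The empty set separates no
pair, so only the condition `empty` controls it. -/
theorem isCompact_setOf_sum_eq (c : ℝ) :
    IsCompact {y | IsMoatPacking x r y ∧ ∑ S, y S = c} := by
  have heq : {y | IsMoatPacking x r y ∧ ∑ S, y S = c} =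
      (⋂ S, {y : Finset ι → ℝ | 0 ≤ y S}) ∩ (⋂ S, ⋂ (_ : r ∈ S), {y | y S = 0}) ∩ {y | y ∅ = 0} ∩
      (⋂ i, ⋂ j, {y | ∑ S, (if (i ∈ S ↔ j ∈ S) then 0 else y S) ≤ dist (x i) (x j)}) ∩
      {y | ∑ S, y S = c} := by
    ext y
    simp only [Set.mem_ofPred_eq, Set.mem_inter_iff, Set.mem_iInter]
    exact ⟨fun ⟨⟨a, b, c, d⟩, e⟩ => ⟨⟨⟨⟨a, b⟩, c⟩, d⟩, e⟩,
      fun ⟨⟨⟨⟨a, b⟩, c⟩, d⟩, e⟩ => ⟨⟨a, b, c, d⟩, e⟩⟩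
  refine IsCompact.of_isClosed_subset
    (isCompact_univ_pi fun S : Finset ι => isCompact_Icc (a := (0 : ℝ)) (b := ∑ i, dist (x r) (x i)))
    ?_ ?_
  · rw [heq]
    have hc : ∀ i j (S : Finset ι), Continuous fun y : Finset ι → ℝ =>
        if (i ∈ S ↔ j ∈ S) then (0 : ℝ) else y S := fun i j S => by
      split_ifs <;> fun_prop
    refine ((((isClosed_iInter fun S => ?_).inter (isClosed_iInter fun S => isClosed_iInter
      fun _ => ?_)).inter ?_).inter (isClosed_iInter fun i => isClosed_iInter fun j => ?_)).inter ?_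
    · exact isClosed_le (by fun_prop) (by fun_prop)
    · exact isClosed_eq (by fun_prop) (by fun_prop)
    · exact isClosed_eq (by fun_prop) (by fun_prop)
    · exact isClosed_le (continuous_finsetSum _ fun S _ => hc i j S) continuous_const
    · exact isClosed_eq (by fun_prop) (by fun_prop)
  · rintro y ⟨h, -⟩ S -
    refine ⟨h.nonneg S, ?_⟩
    rcases S.eq_empty_or_nonempty with rfl | ⟨i, hi⟩
    · rw [h.empty]; exact Finset.sum_nonneg fun _ _ => dist_nonneg
    · exact (h.le_dist hi).trans (Finset.single_le_sum (f := fun i => dist (x r) (x i))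
        (fun _ _ => dist_nonneg) (Finset.mem_univ i))

theorem sum_uncross (g : Finset ι → ℝ) (y : Finset ι → ℝ) (ε : ℝ) (S T : Finset ι) :
    ∑ U, g U * (y U + ε * ((if U = S ∩ T then 1 else 0) + (if U = S ∪ T then 1 else 0)
      - (if U = S then 1 else 0) - (if U = T then 1 else 0))) =
    ∑ U, g U * y U + ε * (g (S ∩ T) + g (S ∪ T) - g S - g T) := by
  simp only [mul_add, mul_sub, Finset.sum_add_distrib, Finset.sum_sub_distrib, mul_ite, mul_one,
    mul_zero, Finset.sum_ite_eq', Finset.mem_univ, if_true]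
  ring

/-- The indicator of separating a fixed pair is submodular, so moving weight from `S` and `T` to
their intersection and union preserves the distance constraints. Non-disjointness keeps the weight
off the empty set. -/
theorem uncross (h : IsMoatPacking x r y) {S T : Finset ι} (hST : ¬ S ⊆ T) (hTS : ¬ T ⊆ S)
    (hd : ¬ Disjoint S T) {ε : ℝ} (hε : 0 ≤ ε) (hS : ε ≤ y S) (hT : ε ≤ y T)
    (hrS : r ∉ S) (hrT : r ∉ T) :
    IsMoatPacking x r fun U => y U + ε * ((if U = S ∩ T then 1 else 0)
      + (if U = S ∪ T then 1 else 0) - (if U = S then 1 else 0) - (if U = T then 1 else 0)) := by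
  have hne : S ≠ T := fun h => hST h.le
  have h1 : S ∩ T ≠ ∅ := fun h => hd (Finset.disjoint_iff_inter_eq_empty.2 h)
  have h2 : S ∪ T ≠ ∅ := fun h => hST (by simp [(Finset.union_eq_empty.1 h).1])
  have h3 : S ≠ ∅ := fun h => hST (by simp [h])
  have h4 : T ≠ ∅ := fun h => hTS (by simp [h])
  refine ⟨fun U => ?_, fun U hU => ?_, ?_, fun i j => ?_⟩
  · have h0 := h.nonneg U
    have a1 : (0 : ℝ) ≤ if U = S ∩ T then 1 else 0 := by split_ifs <;> simp
    have a2 : (0 : ℝ) ≤ if U = S ∪ T then 1 else 0 := by split_ifs <;> simp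
    have a3 := mul_nonneg hε a1
    have a4 := mul_nonneg hε a2
    by_cases hUS : U = S
    · have hUT : U ≠ T := fun h => hne (hUS ▸ h)
      have hU : ε ≤ y U := hUS ▸ hS
      rw [if_pos hUS, if_neg hUT]; linarith
    · by_cases hUT : U = T
      · have hU : ε ≤ y U := hUT ▸ hT
        rw [if_neg hUS, if_pos hUT]; linarith
      · rw [if_neg hUS, if_neg hUT]; linarith
  · have b1 : U ≠ S := by rintro rfl; exact hrS hU
    have b2 : U ≠ T := by rintro rfl; exact hrT hU
    have b3 : U ≠ S ∩ T := by rintro rfl; exact hrS (Finset.mem_inter.1 hU).1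
    have b4 : U ≠ S ∪ T := by
      rintro rfl
      exact (Finset.mem_union.1 hU).elim hrS hrT
    simp [b1, b2, b3, b4, h.root U hU]
  · simp [h1.symm, h2.symm, h3.symm, h4.symm, h.empty]
  · have hg : ∀ z : Finset ι → ℝ, ∑ U, (if (i ∈ U ↔ j ∈ U) then 0 else z U) =
        ∑ U, (if (i ∈ U ↔ j ∈ U) then 0 else 1) * z U := fun z =>
      Finset.sum_congr rfl fun U _ => by split_ifs <;> simp
    have := h.sep_le i j
    rw [hg] at this ⊢
    rw [sum_uncross]
    refine le_trans (add_le_of_nonpos_right ?_) this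
    refine mul_nonpos_of_nonneg_of_nonpos hε ?_
    by_cases iS : i ∈ S <;> by_cases iT : i ∈ T <;> by_cases jS : j ∈ S <;> by_cases jT : j ∈ T <;>
      simp [iS, iT, jS, jT]

/-- Every moat packing can be replaced by a laminar one with the same total weight. -/
theorem exists_laminar (h : IsMoatPacking x r y) :
    ∃ y', IsMoatPacking x r y' ∧ ∑ S, y' S = ∑ S, y S ∧
      ∀ S T, y' S ≠ 0 → y' T ≠ 0 → S ⊆ T ∨ T ⊆ S ∨ Disjoint S T := by
  -- Uncrossing keeps the total weight but strictly increases this convex function of the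
  -- cardinalities, so a maximizer has no crossing pair.
  obtain ⟨y', ⟨hy', hsum⟩, hmax⟩ := (isCompact_setOf_sum_eq (x := x) (r := r)
    (∑ S, y S)).exists_isMaxOn ⟨y, h, rfl⟩
    (f := fun y => ∑ S : Finset ι, ((S.card : ℝ) ^ 2) * y S) (by fun_prop)
  refine ⟨y', hy', hsum, fun S T hS hT => ?_⟩
  by_contra! hcon
  obtain ⟨hST, hTS, hd⟩ := hcon
  have hrS : r ∉ S := fun hr => hS (hy'.root S hr)
  have hrT : r ∉ T := fun hr => hT (hy'.root T hr)
  have hε : 0 < min (y' S) (y' T) :=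
    lt_min ((hy'.nonneg S).lt_of_ne' hS) ((hy'.nonneg T).lt_of_ne' hT)
  have hu := hy'.uncross hST hTS hd hε.le (min_le_left _ _) (min_le_right _ _) hrS hrT
  have hs := sum_uncross (fun _ => 1) y' (min (y' S) (y' T)) S T
  simp only [one_mul, add_sub_cancel_right, sub_self, mul_zero, add_zero] at hs
  have hm := hmax ⟨hu, hs.trans hsum⟩
  simp only [Set.mem_ofPred_eq] at hm
  rw [sum_uncross (fun S => (S.card : ℝ) ^ 2)] at hm
  have hm' : ((S ∩ T).card : ℝ) ^ 2 + ((S ∪ T).card : ℝ) ^ 2 - (S.card : ℝ) ^ 2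
      - (T.card : ℝ) ^ 2 ≤ 0 := by
    by_contra! hpos
    linarith [mul_pos hε hpos]
  have e1 : ((S ∪ T).card : ℝ) + (S ∩ T).card = S.card + T.card := by
    exact_mod_cast Finset.card_union_add_card_inter S T
  have e2 : ((S ∩ T).card : ℝ) < S.card := by
    exact_mod_cast Finset.card_lt_card (Finset.inter_subset_left.ssubset_of_ne
      fun h => hST (Finset.inter_eq_left.1 h))
  have e3 : ((S ∩ T).card : ℝ) < T.card := by
    exact_mod_cast Finset.card_lt_card (Finset.inter_subset_right.ssubset_of_ne
      fun h => hTS (Finset.inter_eq_right.1 h))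
  have e4 : ((S ∪ T).card : ℝ) = S.card + T.card - (S ∩ T).card := by linarith
  rw [e4] at hm'
  -- The gain per unit weight is `2 (|S| - |S ∩ T|) (|T| - |S ∩ T|)`.
  nlinarith [mul_pos (sub_pos.2 e2) (sub_pos.2 e3)]

theorem sum_le_hausdorffMeasure [MeasurableSpace X] [BorelSpace X]
    (h : IsMoatPacking x r y) {K : Set X} (hK : IsPreconnected K) (hKm : MeasurableSet K)
    (hx : ∀ i, x i ∈ K) : ENNReal.ofReal (∑ S, y S) ≤ μH[1] K := by
  obtain ⟨y', hy', hsum, hlam⟩ := h.exists_laminar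
  rw [← hsum]
  exact hy'.sum_le_hausdorffMeasure_of_laminar hK hKm hx hlam

end IsMoatPacking

/-! ### Oriented lines and the Crofton formula -/

/-- The inner product of `v` with the unit vector of angle `θ`. -/
noncomputable def height (θ : ℝ) (v : EuclideanSpace ℝ (Fin 2)) : ℝ :=
  Real.cos θ * v 0 + Real.sin θ * v 1

/-- The invariant measure on oriented lines of the plane, in the coordinates (angle, height). -/
noncomputable def lineMeasure : Measure (ℝ × ℝ) :=
  (volume.restrict (Set.Ioc 0 (2 * Real.pi))).prod volume

/-- The oriented lines crossed upwards by the segment from `a` to `b`. -/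
def upCrossing (a b : EuclideanSpace ℝ (Fin 2)) : Set (ℝ × ℝ) :=
  {p | height p.1 a < p.2 ∧ p.2 ≤ height p.1 b}

/-- The normalizing constant in the Crofton formula. -/
noncomputable def croftonConst : ℝ := ∫ θ in 0..2 * Real.pi, max (Real.cos θ) 0

theorem croftonConst_pos : 0 < croftonConst := by
  refine intervalIntegral.integral_pos (by positivity) (by fun_prop)
    (fun x _ => le_max_right _ _) ⟨0, ⟨le_rfl, by positivity⟩, by simp⟩

@[fun_prop]
theorem continuous_height (v : EuclideanSpace ℝ (Fin 2)) : Continuous fun θ => height θ v := by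
  unfold height; fun_prop

theorem measurableSet_height_lt (a : EuclideanSpace ℝ (Fin 2)) :
    MeasurableSet {p : ℝ × ℝ | height p.1 a < p.2} :=
  measurableSet_lt (by
    have := (continuous_height a).measurable
    fun_prop) (by fun_prop)

theorem upCrossing_eq (a b : EuclideanSpace ℝ (Fin 2)) :
    upCrossing a b = {p | height p.1 a < p.2} \ {p | height p.1 b < p.2} := by
  ext p; simp [upCrossing]

theorem measurableSet_upCrossing (a b : EuclideanSpace ℝ (Fin 2)) :
    MeasurableSet (upCrossing a b) := by
  rw [upCrossing_eq]
  exact (measurableSet_height_lt a).diff (measurableSet_height_lt b)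

theorem exists_height_sub_eq (a b : EuclideanSpace ℝ (Fin 2)) :
    ∃ φ, ∀ θ, height θ b - height θ a = dist a b * Real.cos (θ - φ) := by
  let z : ℂ := ⟨b 0 - a 0, b 1 - a 1⟩
  have hz : ‖z‖ = dist a b := by
    rw [dist_comm, EuclideanSpace.dist_eq, Complex.norm_def, Complex.normSq_apply]
    simp [z, Fin.sum_univ_two, Real.dist_eq, pow_two]
  refine ⟨z.arg, fun θ => ?_⟩
  have h1 : dist a b * Real.cos z.arg = b 0 - a 0 := hz ▸ Complex.norm_mul_cos_arg z
  have h2 : dist a b * Real.sin z.arg = b 1 - a 1 := hz ▸ Complex.norm_mul_sin_arg z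
  rw [Real.cos_sub, height, height]
  linear_combination -Real.cos θ * h1 - Real.sin θ * h2

/-- **Crofton formula** for a segment. -/
theorem lineMeasure_upCrossing (a b : EuclideanSpace ℝ (Fin 2)) :
    lineMeasure (upCrossing a b) = ENNReal.ofReal (croftonConst * dist a b) := by
  obtain ⟨φ, hφ⟩ := exists_height_sub_eq a b
  have hslice : ∀ θ, volume (Prod.mk θ ⁻¹' upCrossing a b) =
      ENNReal.ofReal (dist a b * max (Real.cos (θ - φ)) 0) := by
    intro θ
    have : Prod.mk θ ⁻¹' upCrossing a b = Set.Ioc (height θ a) (height θ b) := by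
      ext t; simp [upCrossing]
    rw [this, Real.volume_Ioc, hφ, mul_max_of_nonneg _ _ dist_nonneg, mul_zero]
    rw [ENNReal.ofReal_max]; simp
  rw [lineMeasure, Measure.prod_apply (measurableSet_upCrossing a b)]
  simp_rw [hslice]
  rw [← ofReal_integral_eq_lintegral_ofReal]
  · congr 1
    rw [← intervalIntegral.integral_of_le (by positivity), intervalIntegral.integral_const_mul,
      intervalIntegral.integral_comp_sub_right (fun x => max (Real.cos x) 0), mul_comm]
    congr 1
    -- The direction of the segment only shifts the angle, which does not affect an integral over a
    -- full period.
    have hp : Function.Periodic (fun x => max (Real.cos x) 0) (2 * Real.pi) := fun x => by simp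
    have := hp.intervalIntegral_add_eq (0 - φ) 0
    rw [zero_add] at this
    rw [croftonConst, ← this]
    congr 1
    ring
  · exact (Continuous.integrableOn_Ioc (by fun_prop))
  · exact Filter.Eventually.of_forall fun x => mul_nonneg dist_nonneg (le_max_right _ _)

/-! ### From line measures to moat packings -/

section Pattern

variable {ι : Type*}

/-- The oriented lines for which `S` is the set of the `i` such that `x i` and `x r` lie on
different sides. -/
def separatingLines (x : ι → EuclideanSpace ℝ (Fin 2)) (r : ι) (S : Finset ι) : Set (ℝ × ℝ) :=
  {p | ∀ i, i ∈ S ↔ ¬ (height p.1 (x i) < p.2 ↔ height p.1 (x r) < p.2)}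

variable (x : ι → EuclideanSpace ℝ (Fin 2)) (r : ι)

theorem measurableSet_separatingLines [Finite ι] (S : Finset ι) :
    MeasurableSet (separatingLines x r S) := by
  have : separatingLines x r S =
      ⋂ i, {p | i ∈ S ↔ ¬ (height p.1 (x i) < p.2 ↔ height p.1 (x r) < p.2)} := by
    ext p; simp [separatingLines]
  rw [this]
  exact MeasurableSet.iInter fun i => (MeasurableSet.const _).iff
    (((measurableSet_height_lt (x i)).iff (measurableSet_height_lt (x r))).compl)

theorem disjoint_separatingLines {S T : Finset ι} (h : S ≠ T) :
    Disjoint (separatingLines x r S) (separatingLines x r T) := by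
  rw [Set.disjoint_left]
  intro p hS hT
  exact h (Finset.ext fun i => (hS i).trans (hT i).symm)

theorem separatingLines_of_root_mem {S : Finset ι} (h : r ∈ S) : separatingLines x r S = ∅ := by
  rw [Set.eq_empty_iff_forall_notMem]
  intro p hp
  simpa using (hp r).1 h

theorem exists_mem_separatingLines [Fintype ι] (p : ℝ × ℝ) : ∃ S, p ∈ separatingLines x r S := by
  classical
  exact ⟨Finset.univ.filter fun i => ¬ (height p.1 (x i) < p.2 ↔ height p.1 (x r) < p.2),
    fun i => by simp⟩

theorem sum_lineMeasure_separatingLines [Finite ι] (s : Finset (Finset ι)) :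
    ∑ S ∈ s, lineMeasure (separatingLines x r S) =
      lineMeasure (⋃ S ∈ s, separatingLines x r S) :=
  (measure_biUnion_finset (fun _ _ _ _ h => disjoint_separatingLines x r h)
    fun S _ => measurableSet_separatingLines x r S).symm

variable [Fintype ι] [DecidableEq ι]

theorem upCrossing_union_eq (i j : ι) : upCrossing (x i) (x j) ∪ upCrossing (x j) (x i) =
    ⋃ S ∈ Finset.univ.filter (fun S : Finset ι => ¬ (i ∈ S ↔ j ∈ S)), separatingLines x r S := by
  ext p
  obtain ⟨S, hS⟩ := exists_mem_separatingLines x r p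
  have h1 : (p ∈ ⋃ S ∈ Finset.univ.filter (fun S : Finset ι => ¬ (i ∈ S ↔ j ∈ S)),
      separatingLines x r S) ↔ ¬ (i ∈ S ↔ j ∈ S) := by
    simp only [Set.mem_iUnion, Finset.mem_filter, Finset.mem_univ, true_and, exists_prop]
    refine ⟨fun ⟨T, hT, hpT⟩ => ?_, fun h => ⟨S, h, hS⟩⟩
    have : S = T := Finset.ext fun k => (hS k).trans (hpT k).symm
    rwa [this]
  rw [h1, hS i, hS j, upCrossing_eq, upCrossing_eq]
  simp only [Set.mem_union, Set.mem_sdiff, Set.mem_ofPred_eq]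
  tauto

theorem disjoint_upCrossing_swap (a b : EuclideanSpace ℝ (Fin 2)) :
    Disjoint (upCrossing a b) (upCrossing b a) := by
  rw [Set.disjoint_left]
  rintro p ⟨h1, h2⟩ ⟨h3, h4⟩
  linarith

theorem sum_separating_lineMeasure (i j : ι) :
    ∑ S : Finset ι with ¬ (i ∈ S ↔ j ∈ S), lineMeasure (separatingLines x r S) =
      ENNReal.ofReal (2 * croftonConst * dist (x i) (x j)) := by
  rw [sum_lineMeasure_separatingLines, ← upCrossing_union_eq,
    measure_union (disjoint_upCrossing_swap _ _) (measurableSet_upCrossing _ _),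
    lineMeasure_upCrossing, lineMeasure_upCrossing, dist_comm (x j),
    ← ENNReal.ofReal_add (by have := croftonConst_pos; positivity)
      (by have := croftonConst_pos; positivity)]
  congr 1
  ring

/-- These lines separate the root from some point of `S`, so Crofton bounds their measure. The empty
pattern consists of the lines separating no points and has infinite measure. -/
theorem lineMeasure_separatingLines_ne_top {S : Finset ι} (hS : S ≠ ∅) :
    lineMeasure (separatingLines x r S) ≠ ⊤ := by
  by_cases hr : r ∈ S
  · simp [separatingLines_of_root_mem x r hr]
  obtain ⟨i, hi⟩ := Finset.nonempty_iff_ne_empty.2 hS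
  refine ne_top_of_le_ne_top (ENNReal.ofReal_ne_top (r := 2 * croftonConst * dist (x r) (x i))) ?_
  rw [← sum_separating_lineMeasure]
  exact Finset.single_le_sum (f := fun S => lineMeasure (separatingLines x r S))
    (fun _ _ => zero_le) (by simp [hr, hi])

/-- The moat packing given by the measures of the sets of separating lines. -/
noncomputable def croftonWeight (S : Finset ι) : ℝ :=
  if S = ∅ then 0 else (lineMeasure (separatingLines x r S)).toReal / (2 * croftonConst)

theorem isMoatPacking_croftonWeight : IsMoatPacking x r (croftonWeight x r) where
  nonneg S := by
    have := croftonConst_pos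
    unfold croftonWeight; split_ifs <;> positivity
  root S hS := by simp [croftonWeight, separatingLines_of_root_mem x r hS]
  empty := by simp [croftonWeight]
  sep_le i j := by
    have hc := croftonConst_pos
    have h1 : ∀ S : Finset ι, (if (i ∈ S ↔ j ∈ S) then 0 else croftonWeight x r S) =
        if ¬ (i ∈ S ↔ j ∈ S) then
          (lineMeasure (separatingLines x r S)).toReal / (2 * croftonConst) else 0 := by
      intro S
      by_cases hS : i ∈ S ↔ j ∈ S
      · simp [hS]
      · have : S ≠ ∅ := by rintro rfl; simp at hS
        simp [hS, croftonWeight, this]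
    simp_rw [h1]
    rw [← Finset.sum_filter, ← Finset.sum_div, ← ENNReal.toReal_sum, sum_separating_lineMeasure,
      ENNReal.toReal_ofReal (by positivity)]
    · exact le_of_eq (by field_simp)
    · intro S hS
      refine lineMeasure_separatingLines_ne_top x r ?_
      rintro rfl
      simp at hS

theorem ofReal_sum_croftonWeight :
    ENNReal.ofReal (2 * croftonConst * ∑ S, croftonWeight x r S) =
      lineMeasure (⋃ S ∈ Finset.univ.filter (fun S : Finset ι => S ≠ ∅),
        separatingLines x r S) := by
  have hc := croftonConst_pos
  have h1 : 2 * croftonConst * ∑ S, croftonWeight x r S =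
      ∑ S : Finset ι with S ≠ ∅, (lineMeasure (separatingLines x r S)).toReal := by
    rw [Finset.sum_filter, Finset.mul_sum]
    refine Finset.sum_congr rfl fun S _ => ?_
    by_cases hS : S = ∅
    · simp [hS, croftonWeight]
    · simp only [hS, croftonWeight, if_false, ne_eq, not_false_eq_true, if_true]
      field_simp
  have h2 : ∀ S ∈ Finset.univ.filter (fun S : Finset ι => S ≠ ∅),
      lineMeasure (separatingLines x r S) ≠ ⊤ := fun S hS =>
    lineMeasure_separatingLines_ne_top x r (Finset.mem_filter.1 hS).2
  rw [h1, ← ENNReal.toReal_sum h2, ENNReal.ofReal_toReal (ENNReal.sum_ne_top.2 h2),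
    sum_lineMeasure_separatingLines]

/-- If the sets of lines crossed upwards by the segments joining some pairs of the points `x i` are
pairwise disjoint, then the total length of the segments is at most twice the length of any
connected set containing all the `x i`. -/
theorem sum_dist_le_two_mul_hausdorffMeasure {K : Set (EuclideanSpace ℝ (Fin 2))}
    (hK : IsPreconnected K) (hKm : MeasurableSet K) (hx : ∀ i, x i ∈ K) (s : Finset (ι × ι))
    (hs : (s : Set (ι × ι)).PairwiseDisjoint fun e => upCrossing (x e.1) (x e.2)) :
    ∑ e ∈ s, edist (x e.1) (x e.2) ≤ 2 * μH[1] K := by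
  have hc := croftonConst_pos
  rcases s.eq_empty_or_nonempty with rfl | ⟨e₀, -⟩
  · simp
  let r := e₀.1
  have h1 : ENNReal.ofReal (croftonConst * ∑ e ∈ s, dist (x e.1) (x e.2)) ≤
      ENNReal.ofReal (2 * croftonConst * ∑ S, croftonWeight x r S) := by
    rw [ofReal_sum_croftonWeight, Finset.mul_sum, ENNReal.ofReal_sum_of_nonneg
      (fun _ _ => by positivity)]
    simp_rw [← lineMeasure_upCrossing]
    rw [← measure_biUnion_finset hs fun e _ => measurableSet_upCrossing _ _]
    refine measure_mono (Set.iUnion₂_subset fun e _ => ?_)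
    refine (Set.subset_union_left.trans (upCrossing_union_eq x r e.1 e.2).subset).trans ?_
    refine Set.biUnion_subset_biUnion_left fun S hS => ?_
    refine Finset.mem_filter.2 ⟨Finset.mem_univ S, ?_⟩
    rintro rfl
    simpa using (Finset.mem_filter.1 hS).2
  have hP := isMoatPacking_croftonWeight x r
  have hnn : 0 ≤ ∑ S, croftonWeight x r S := Finset.sum_nonneg fun S _ => hP.nonneg S
  rw [ENNReal.ofReal_le_ofReal_iff (by positivity)] at h1
  have h2 : ∑ e ∈ s, dist (x e.1) (x e.2) ≤ 2 * ∑ S, croftonWeight x r S := by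
    refine le_of_mul_le_mul_left ?_ hc
    linarith
  simp_rw [edist_dist]
  rw [← ENNReal.ofReal_sum_of_nonneg fun _ _ => dist_nonneg]
  refine (ENNReal.ofReal_le_ofReal h2).trans ?_
  rw [ENNReal.ofReal_mul zero_le_two, ENNReal.ofReal_ofNat]
  gcongr
  exact hP.sum_le_hausdorffMeasure hK hKm hx

end Pattern

/-! ### Supporting normals and monotonicity of perimeter -/

theorem IsPreconnected.inter_frontier_nonempty {X : Type*} [TopologicalSpace X] {s t : Set X}
    (ht : IsPreconnected t) (hs : (t ∩ s).Nonempty) (hsc : (t ∩ sᶜ).Nonempty) :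
    (t ∩ frontier s).Nonempty := by
  by_contra hempty
  have hout : ∀ x ∈ t, x ∈ closure s → x ∈ interior s := fun x hx hxs => by
    by_contra hxi
    exact hempty ⟨x, hx, hxs, hxi⟩
  obtain ⟨x, -, hx, hx'⟩ := ht (interior s) (closure s)ᶜ isOpen_interior
    isClosed_closure.isOpen_compl
    (fun x hx => (em (x ∈ closure s)).imp (hout x hx) id)
    (hs.imp fun x hx => ⟨hx.1, hout x hx.1 (subset_closure hx.2)⟩)
    (hsc.imp fun x hx => ⟨hx.1, fun h => hx.2 (interior_subset (hout x hx.1 h))⟩)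
  exact hx' (subset_closure (interior_subset hx))

section Support

variable {E : Type*} [NormedAddCommGroup E] [InnerProductSpace ℝ E] [CompleteSpace E]

theorem Convex.exists_supporting_normal {C : Set E} (hC : Convex ℝ C) (hint : (interior C).Nonempty)
    {c : E} (hc : c ∈ frontier C) :
    ∃ n : E, n ≠ 0 ∧ ∀ x ∈ closure C, inner ℝ n x ≤ inner ℝ n c := by
  obtain ⟨f, hf⟩ := geometric_hahn_banach_open_point hC.interior isOpen_interior hc.2
  have hn : ∀ x, inner ℝ ((InnerProductSpace.toDual ℝ E).symm f) x = f x := fun x => by simp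
  refine ⟨(InnerProductSpace.toDual ℝ E).symm f, ?_, fun x hx => ?_⟩
  · intro h0
    obtain ⟨a, ha⟩ := hint
    have := hf a ha
    rw [← hn, ← hn, h0] at this
    simp at this
  · rw [hn, hn]
    rw [← hC.closure_interior_eq_closure_of_nonempty_interior hint] at hx
    exact closure_minimal (fun a ha => (hf a ha).le)
      (isClosed_le f.continuous continuous_const) hx

/-- The perimeter of convex sets is monotone under inclusion. -/
theorem Convex.hausdorffMeasure_frontier_le [MeasurableSpace E] [BorelSpace E] {C Q : Set E}
    (hC : Convex ℝ C) (hint : (interior C).Nonempty) (hCQ : C ⊆ Q) (hQ : IsCompact Q) {d : ℝ}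
    (hd : 0 ≤ d) : μH[d] (frontier C) ≤ μH[d] (frontier Q) := by
  have hcl : closure C ⊆ Q := closure_minimal hCQ hQ.isClosed
  -- Follow the outward normal ray from `c` until it meets the frontier of `Q`. Two points within
  -- norm `R` are at most `2 * R` apart, so the ray has left `Q` at distance `2 * R + 1`.
  have key : ∀ c : frontier C, ∃ q ∈ frontier Q, ∀ x ∈ closure C,
      inner ℝ (q - c) (x - c) ≤ 0 := by
    rintro ⟨c, hc⟩
    obtain ⟨n, hn, hsup⟩ := hC.exists_supporting_normal hint hc
    obtain ⟨R, hR⟩ := hQ.isBounded.exists_norm_le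
    have hpos : 0 < ‖n‖ := norm_pos_iff.2 hn
    have hray : IsPreconnected ((fun t : ℝ => c + t • n) '' Set.Ici 0) :=
      isPreconnected_Ici.image _ (by fun_prop)
    have hcQ := hcl hc.1
    have hR0 : 0 ≤ R := (norm_nonneg c).trans (hR c hcQ)
    obtain ⟨q, ⟨t, ht, rfl⟩, hq⟩ := hray.inter_frontier_nonempty (s := Q)
      ⟨c, ⟨0, by simp, by simp⟩, hcQ⟩
      ⟨c + ((2 * R + 1) / ‖n‖) • n, ⟨(2 * R + 1) / ‖n‖, by
        simp only [Set.mem_Ici]; positivity, rfl⟩, fun hmem => by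
        have h1 := hR _ hmem
        have h2 := hR c hcQ
        have h3 : ‖((2 * R + 1) / ‖n‖) • n‖ = 2 * R + 1 := by
          rw [norm_smul, Real.norm_of_nonneg (by positivity)]
          field_simp
        have h4 := norm_sub_le (c + ((2 * R + 1) / ‖n‖) • n) c
        rw [add_sub_cancel_left, h3] at h4
        linarith⟩
    refine ⟨_, hq, fun x hx => ?_⟩
    rw [add_sub_cancel_left, inner_smul_left, inner_sub_right]
    exact mul_nonpos_of_nonneg_of_nonpos (by simpa using ht) (by linarith [hsup x hx])
  choose q hq hq' using key
  have hanti : AntilipschitzWith 1 q := by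
    refine AntilipschitzWith.of_le_mul_dist fun a b => ?_
    rw [NNReal.coe_one, one_mul, Subtype.dist_eq, dist_eq_norm, dist_eq_norm]
    have h1 := hq' a b b.2.1
    have h2 := hq' b a a.2.1
    -- Adding the two supporting inequalities shows that moving outwards along normals does not
    -- bring points closer.
    have h3 : ‖(a : E) - b‖ ^ 2 ≤ inner ℝ (q a - q b) ((a : E) - b) := by
      rw [← real_inner_self_eq_norm_sq]
      simp only [inner_sub_left, inner_sub_right] at h1 h2 ⊢
      linarith
    have h4 := h3.trans (real_inner_le_norm _ _)
    rcases (norm_nonneg ((a : E) - b)).eq_or_lt with h0 | h0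
    · rw [← h0]; exact norm_nonneg _
    · rw [pow_two] at h4
      exact le_of_mul_le_mul_right h4 h0
  calc μH[d] (frontier C) = μH[d] (Set.univ : Set (frontier C)) := by
        rw [← (isometry_subtype_coe (s := frontier C)).hausdorffMeasure_image (Or.inl hd)]
        simp
    _ ≤ μH[d] (q '' Set.univ) := by simpa using hanti.le_hausdorffMeasure_image hd Set.univ
    _ ≤ μH[d] (frontier Q) := measure_mono (by rintro _ ⟨c, -, rfl⟩; exact hq c)

end Support

/-! ### Edges of a convex polygon -/

/-- Signed area of the parallelogram with vertex `a` spanned by `b` and `x`. -/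
def cross (a b x : EuclideanSpace ℝ (Fin 2)) : ℝ :=
  (b 0 - a 0) * (x 1 - a 1) - (b 1 - a 1) * (x 0 - a 0)

/-- `(a, b)` is a positively oriented maximal edge of the convex hull of `F`. -/
def IsEdge (F : Finset (EuclideanSpace ℝ (Fin 2))) (a b : EuclideanSpace ℝ (Fin 2)) : Prop :=
  ∀ x ∈ F, 0 ≤ cross a b x ∧ (cross a b x = 0 → x ∈ segment ℝ a b)

theorem height_mem_Icc {a b x : EuclideanSpace ℝ (Fin 2)} {θ : ℝ} (hx : x ∈ segment ℝ a b)
    (hab : height θ a < height θ b) :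
    (height θ a ≤ height θ x ∧ (height θ x ≤ height θ a → x = a)) ∧
      (height θ x ≤ height θ b ∧ (height θ b ≤ height θ x → x = b)) := by
  rw [segment_eq_image] at hx
  obtain ⟨τ, ⟨h0, h1⟩, rfl⟩ := hx
  have hh : height θ ((1 - τ) • a + τ • b) = height θ a + τ * (height θ b - height θ a) := by
    simp [height]; ring
  simp only [hh]
  have hpos := sub_pos.2 hab
  refine ⟨⟨by nlinarith, fun h => ?_⟩, ⟨by nlinarith, fun h => ?_⟩⟩
  · have : τ = 0 := by
      refine le_antisymm ?_ h0
      by_contra! hτ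
      nlinarith [mul_pos hτ hpos]
    simp [this]
  · have : τ = 1 := by
      refine le_antisymm h1 ?_
      by_contra! hτ
      nlinarith [mul_pos (sub_pos.2 hτ) hpos]
    simp [this]

/-- Here `k` is the displacement along the line from its intersection with `a b` to its intersection
with `a' b'`. Since `cross a b` is affine and vanishes on the first edge, its value at the second
intersection is `k` times the height gain of that edge. -/
theorem IsEdge.cross_nonneg_of_crossing {F : Finset (EuclideanSpace ℝ (Fin 2))}
    {a b a' b' : EuclideanSpace ℝ (Fin 2)} (h : IsEdge F a b) (ha' : a' ∈ F) (hb' : b' ∈ F)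
    {θ σ σ' k : ℝ} (hab : height θ a < height θ b) (hσ' : 0 < σ') (hσ1 : σ' ≤ 1)
    (h0 : a' 0 + σ' * (b' 0 - a' 0) = a 0 + σ * (b 0 - a 0) - k * Real.sin θ)
    (h1 : a' 1 + σ' * (b' 1 - a' 1) = a 1 + σ * (b 1 - a 1) + k * Real.cos θ) :
    0 ≤ k ∧ (k = 0 → b' ∈ segment ℝ a b) := by
  have e1 := (h a' ha').1
  have e2 := (h b' hb').1
  have e : (1 - σ') * cross a b a' + σ' * cross a b b' = k * (height θ b - height θ a) := by
    unfold cross height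
    linear_combination (b 0 - a 0) * h1 - (b 1 - a 1) * h0
  have p1 := mul_nonneg (sub_nonneg.2 hσ1) e1
  have p2 := mul_nonneg hσ'.le e2
  have hpos := sub_pos.2 hab
  constructor
  · by_contra! hk
    nlinarith [mul_pos (neg_pos.2 hk) hpos]
  · rintro rfl
    refine (h b' hb').2 ?_
    have : σ' * cross a b b' = 0 := by linarith
    exact (mul_eq_zero.1 this).resolve_left hσ'.ne'

/-- Two positively oriented edges crossed upwards by the same line coincide. -/
theorem IsEdge.eq_of_mem_upCrossing {F : Finset (EuclideanSpace ℝ (Fin 2))}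
    {a b a' b' : EuclideanSpace ℝ (Fin 2)} (h : IsEdge F a b) (h' : IsEdge F a' b')
    (ha : a ∈ F) (hb : b ∈ F) (ha' : a' ∈ F) (hb' : b' ∈ F) {p : ℝ × ℝ}
    (hp : p ∈ upCrossing a b) (hp' : p ∈ upCrossing a' b') : a = a' ∧ b = b' := by
  obtain ⟨θ, t⟩ := p
  obtain ⟨l1, l2⟩ := hp
  obtain ⟨l3, l4⟩ := hp'
  simp only at l1 l2 l3 l4
  have hab := l1.trans_le l2
  have hab' := l3.trans_le l4
  obtain ⟨σ, hσ⟩ : ∃ σ, σ = (t - height θ a) / (height θ b - height θ a) := ⟨_, rfl⟩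
  obtain ⟨σ', hσ'⟩ : ∃ σ', σ' = (t - height θ a') / (height θ b' - height θ a') := ⟨_, rfl⟩
  have s0 : 0 < σ := hσ ▸ div_pos (by linarith) (by linarith)
  have s1 : σ ≤ 1 := hσ ▸ (div_le_one (by linarith)).2 (by linarith)
  have s0' : 0 < σ' := hσ' ▸ div_pos (by linarith) (by linarith)
  have s1' : σ' ≤ 1 := hσ' ▸ (div_le_one (by linarith)).2 (by linarith)
  have t1 : σ * (height θ b - height θ a) = t - height θ a := by
    rw [hσ, div_mul_cancel₀]; linarith
  have t2 : σ' * (height θ b' - height θ a') = t - height θ a' := by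
    rw [hσ', div_mul_cancel₀]; linarith
  have ht : Real.cos θ * (a' 0 + σ' * (b' 0 - a' 0) - (a 0 + σ * (b 0 - a 0))) +
      Real.sin θ * (a' 1 + σ' * (b' 1 - a' 1) - (a 1 + σ * (b 1 - a 1))) = 0 := by
    unfold height at t1 t2
    linear_combination t2 - t1
  have hsc := Real.sin_sq_add_cos_sq θ
  obtain ⟨k, hk⟩ : ∃ k, k = Real.cos θ * (a' 1 + σ' * (b' 1 - a' 1) - (a 1 + σ * (b 1 - a 1))) -
      Real.sin θ * (a' 0 + σ' * (b' 0 - a' 0) - (a 0 + σ * (b 0 - a 0))) := ⟨_, rfl⟩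
  have k0 : a' 0 + σ' * (b' 0 - a' 0) = a 0 + σ * (b 0 - a 0) - k * Real.sin θ := by
    linear_combination Real.cos θ * ht + Real.sin θ * hk -
      (a' 0 + σ' * (b' 0 - a' 0) - (a 0 + σ * (b 0 - a 0))) * hsc
  have k1 : a' 1 + σ' * (b' 1 - a' 1) = a 1 + σ * (b 1 - a 1) + k * Real.cos θ := by
    linear_combination Real.sin θ * ht - Real.cos θ * hk -
      (a' 1 + σ' * (b' 1 - a' 1) - (a 1 + σ * (b 1 - a 1))) * hsc
  obtain ⟨m1, m2⟩ := h.cross_nonneg_of_crossing ha' hb' hab s0' s1' k0 k1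
  obtain ⟨m3, m4⟩ := h'.cross_nonneg_of_crossing (σ := σ') (k := -k) ha hb hab' s0 s1
    (by linarith) (by linarith)
  -- Exchanging the two edges reverses the sign of the displacement.
  have hk0 : k = 0 := by linarith
  have q1 := height_mem_Icc (m2 hk0) hab
  have q2 := height_mem_Icc (m4 (by linarith)) hab'
  have hbb : b' = b := q1.2.2 q2.2.1
  subst hbb
  have c1 := h a' ha'
  have c2 := h' a ha
  -- The half-open crossing condition excludes the lower endpoints, so the initial vertices need a
  -- separate argument: these two nonnegative areas are opposite, hence both vanish.
  have c3 : cross a b' a' + cross a' b' a = 0 := by unfold cross; ring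
  have q3 := height_mem_Icc (c1.2 (by linarith)) hab
  have q4 := height_mem_Icc (c2.2 (by linarith)) hab'
  exact ⟨(q3.1.2 q4.1.1).symm, rfl⟩

theorem mem_segment_of_dot {n a b z : EuclideanSpace ℝ (Fin 2)} (hn : n ≠ 0)
    (ha : n 0 * a 0 + n 1 * a 1 = n 0 * z 0 + n 1 * z 1)
    (hb : n 0 * b 0 + n 1 * b 1 = n 0 * z 0 + n 1 * z 1)
    (h1 : n 0 * a 1 - n 1 * a 0 ≤ n 0 * z 1 - n 1 * z 0)
    (h2 : n 0 * z 1 - n 1 * z 0 ≤ n 0 * b 1 - n 1 * b 0) : z ∈ segment ℝ a b := by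
  have hpos : 0 < n 0 ^ 2 + n 1 ^ 2 := by
    by_contra! hle
    refine hn ?_
    have e0 : n 0 = 0 := by nlinarith [sq_nonneg (n 0), sq_nonneg (n 1)]
    have e1 : n 1 = 0 := by nlinarith [sq_nonneg (n 0), sq_nonneg (n 1)]
    ext i
    fin_cases i <;> simp [e0, e1]
  have hext : ∀ w : EuclideanSpace ℝ (Fin 2), n 0 * w 0 + n 1 * w 1 = n 0 * z 0 + n 1 * z 1 →
      n 0 * w 1 - n 1 * w 0 = n 0 * z 1 - n 1 * z 0 → w = z := by
    intro w e1 e2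
    have f0 : (n 0 ^ 2 + n 1 ^ 2) * (w 0 - z 0) = 0 := by
      linear_combination n 0 * e1 - n 1 * e2
    have f1 : (n 0 ^ 2 + n 1 ^ 2) * (w 1 - z 1) = 0 := by
      linear_combination n 1 * e1 + n 0 * e2
    have g0 := (mul_eq_zero.1 f0).resolve_left hpos.ne'
    have g1 := (mul_eq_zero.1 f1).resolve_left hpos.ne'
    ext i
    fin_cases i
    · exact sub_eq_zero.1 g0
    · exact sub_eq_zero.1 g1
  rcases (h1.trans h2).eq_or_lt with heq | hlt
  · rw [hext a ha (by linarith)]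
    exact left_mem_segment ℝ z b
  · rw [segment_eq_image]
    obtain ⟨τ, hτ⟩ : ∃ τ, τ = ((n 0 * z 1 - n 1 * z 0) - (n 0 * a 1 - n 1 * a 0)) /
      ((n 0 * b 1 - n 1 * b 0) - (n 0 * a 1 - n 1 * a 0)) := ⟨_, rfl⟩
    have hτ' : τ * ((n 0 * b 1 - n 1 * b 0) - (n 0 * a 1 - n 1 * a 0)) =
        (n 0 * z 1 - n 1 * z 0) - (n 0 * a 1 - n 1 * a 0) := by
      rw [hτ, div_mul_cancel₀]; linarith
    refine ⟨τ, ⟨hτ ▸ div_nonneg (by linarith) (by linarith),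
      hτ ▸ (div_le_one (by linarith)).2 (by linarith)⟩, hext _ ?_ ?_⟩
    · simp only [PiLp.add_apply, PiLp.smul_apply, smul_eq_mul]
      linear_combination (1 - τ) * ha + τ * hb
    · simp only [PiLp.add_apply, PiLp.smul_apply, smul_eq_mul]
      linear_combination hτ'

/-- The boundary of a convex polygon is covered by its vertices and edges. -/
theorem frontier_convexHull_subset_edges {F : Finset (EuclideanSpace ℝ (Fin 2))}
    (hint : (interior (convexHull ℝ (F : Set (EuclideanSpace ℝ (Fin 2))))).Nonempty)
    {z : EuclideanSpace ℝ (Fin 2)}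
    (hz : z ∈ frontier (convexHull ℝ (F : Set (EuclideanSpace ℝ (Fin 2))))) :
    z ∈ F ∨ ∃ a ∈ F, ∃ b ∈ F, IsEdge F a b ∧ z ∈ segment ℝ a b := by
  obtain ⟨n, hn, hsup⟩ := (convex_convexHull ℝ _).exists_supporting_normal hint hz
  have hin : ∀ x : EuclideanSpace ℝ (Fin 2), inner ℝ n x = n 0 * x 0 + n 1 * x 1 := fun x => by
    simp [PiLp.inner_apply, Fin.sum_univ_two, mul_comm]
  simp only [hin] at hsup
  have hF : ∀ x ∈ F, n 0 * x 0 + n 1 * x 1 ≤ n 0 * z 0 + n 1 * z 1 := fun x hx =>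
    hsup x (subset_closure (subset_convexHull ℝ _ hx))
  have hzc : z ∈ convexHull ℝ (F : Set (EuclideanSpace ℝ (Fin 2))) := by
    have := F.finite_toSet.isClosed_convexHull ℝ
    exact this.closure_eq ▸ hz.1
  obtain ⟨w, hw0, hw1, hwz⟩ := Finset.mem_convexHull'.1 hzc
  have z0 : ∑ x ∈ F, w x * x 0 = z 0 := by rw [← hwz]; simp
  have z1 : ∑ x ∈ F, w x * x 1 = z 1 := by rw [← hwz]; simp
  have hlin : ∀ p q : ℝ, ∑ x ∈ F, w x * (p * x 0 + q * x 1) = p * z 0 + q * z 1 := by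
    intro p q
    rw [← z0, ← z1, Finset.mul_sum, Finset.mul_sum, ← Finset.sum_add_distrib]
    exact Finset.sum_congr rfl fun x _ => by ring
  -- A convex combination attaining the maximum of a linear form puts weight only on points
  -- attaining it.
  have hface : ∀ x ∈ F, w x ≠ 0 → n 0 * x 0 + n 1 * x 1 = n 0 * z 0 + n 1 * z 1 := by
    have hs : ∑ x ∈ F, w x * ((n 0 * z 0 + n 1 * z 1) - (n 0 * x 0 + n 1 * x 1)) = 0 := by
      simp_rw [mul_sub, Finset.sum_sub_distrib]
      rw [hlin, ← Finset.sum_mul, hw1]; ring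
    rw [Finset.sum_eq_zero_iff_of_nonneg fun x hx =>
      mul_nonneg (hw0 x hx) (sub_nonneg.2 (hF x hx))] at hs
    intro x hx hwx
    linarith [(mul_eq_zero.1 (hs x hx)).resolve_left hwx]
  classical
  obtain ⟨G, hG⟩ : ∃ G, G = F.filter
      fun x => n 0 * x 0 + n 1 * x 1 = n 0 * z 0 + n 1 * z 1 := ⟨_, rfl⟩
  have hmemG : ∀ x, x ∈ G ↔ x ∈ F ∧ n 0 * x 0 + n 1 * x 1 = n 0 * z 0 + n 1 * z 1 := fun x => by
    rw [hG, Finset.mem_filter]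
  have hGne : G.Nonempty := by
    by_contra hne
    have : ∑ x ∈ F, w x = 0 := Finset.sum_eq_zero fun x hx => by
      by_contra hwx
      exact hne ⟨x, (hmemG x).2 ⟨hx, hface x hx hwx⟩⟩
    linarith
  -- The edge joins the extreme points of the supporting face along the direction obtained by
  -- rotating `n` by a quarter turn.
  obtain ⟨a, haG, hamin⟩ := G.exists_min_image (fun x => n 0 * x 1 - n 1 * x 0) hGne
  obtain ⟨b, hbG, hbmax⟩ := G.exists_max_image (fun x => n 0 * x 1 - n 1 * x 0) hGne
  obtain ⟨haF, ha⟩ := (hmemG a).1 haG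
  obtain ⟨hbF, hb⟩ := (hmemG b).1 hbG
  have hbound : ∀ p q c : ℝ, (∀ x ∈ G, c ≤ p * x 0 + q * x 1) → c ≤ p * z 0 + q * z 1 := by
    intro p q c hc
    rw [← hlin, ← one_mul c, ← hw1, Finset.sum_mul]
    refine Finset.sum_le_sum fun x hx => ?_
    by_cases hwx : w x = 0
    · simp [hwx]
    · exact mul_le_mul_of_nonneg_left (hc x ((hmemG x).2 ⟨hx, hface x hx hwx⟩)) (hw0 x hx)
  have b1 := hbound (-n 1) (n 0) (n 0 * a 1 - n 1 * a 0) fun x hx => by linarith [hamin x hx]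
  have b2 := hbound (n 1) (-n 0) (-(n 0 * b 1 - n 1 * b 0)) fun x hx => by linarith [hbmax x hx]
  have hzseg : z ∈ segment ℝ a b := mem_segment_of_dot hn ha hb (by linarith) (by linarith)
  rcases (hamin b hbG).eq_or_lt with heq | hlt
  · have hab : b ∈ segment ℝ a a := mem_segment_of_dot hn (ha.trans hb.symm) (ha.trans hb.symm)
      heq.le heq.ge
    rw [segment_same, Set.mem_singleton_iff] at hab
    rw [hab, segment_same, Set.mem_singleton_iff] at hzseg
    exact Or.inl (hzseg ▸ haF)
  · refine Or.inr ⟨a, haF, b, hbF, fun x hx => ?_, hzseg⟩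
    have hpos : 0 < n 0 ^ 2 + n 1 ^ 2 := by
      by_contra! hle
      have e0 : n 0 = 0 := by nlinarith [sq_nonneg (n 0), sq_nonneg (n 1)]
      have e1 : n 1 = 0 := by nlinarith [sq_nonneg (n 0), sq_nonneg (n 1)]
      simp [e0, e1] at hlt
    have hc : (n 0 ^ 2 + n 1 ^ 2) * cross a b x =
        ((n 0 * b 1 - n 1 * b 0) - (n 0 * a 1 - n 1 * a 0)) *
          ((n 0 * z 0 + n 1 * z 1) - (n 0 * x 0 + n 1 * x 1)) := by
      unfold cross
      linear_combination ((n 0 * b 1 - n 1 * b 0) - (n 0 * a 1 - n 1 * a 0)) * ha +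
        (n 0 * (x 1 - a 1) - n 1 * (x 0 - a 0)) * (hb - ha)
    have hm := mul_nonneg (sub_pos.2 hlt).le (sub_nonneg.2 (hF x hx))
    refine ⟨nonneg_of_mul_nonneg_right (hc ▸ hm) hpos, fun h0 => ?_⟩
    rw [h0, mul_zero] at hc
    have hxz := (mul_eq_zero.1 hc.symm).resolve_left (sub_pos.2 hlt).ne'
    have hxG := (hmemG x).2 ⟨hx, by linarith⟩
    exact mem_segment_of_dot hn (by linarith) (by linarith) (hamin x hxG) (hbmax x hxG)

/-- The perimeter bound for convex polygons. -/
theorem hausdorffMeasure_frontier_convexHull_finset_le {K : Set (EuclideanSpace ℝ (Fin 2))}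
    (hK : IsPreconnected K) (hKm : MeasurableSet K) (F : Finset (EuclideanSpace ℝ (Fin 2)))
    (hFK : ∀ x ∈ F, x ∈ K)
    (hint : (interior (convexHull ℝ (F : Set (EuclideanSpace ℝ (Fin 2))))).Nonempty) :
    μH[1] (frontier (convexHull ℝ (F : Set (EuclideanSpace ℝ (Fin 2))))) ≤ 2 * μH[1] K := by
  classical
  let s : Finset (F × F) := Finset.univ.filter fun e => IsEdge F e.1 e.2
  have hs : (s : Set (F × F)).PairwiseDisjoint
      fun e => upCrossing (e.1 : EuclideanSpace ℝ (Fin 2)) e.2 := by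
    intro e he e' he' hne
    refine Set.disjoint_left.2 fun p hp hp' => hne ?_
    obtain ⟨h1, h2⟩ := (Finset.mem_filter.1 he).2.eq_of_mem_upCrossing
      (Finset.mem_filter.1 he').2 e.1.2 e.2.2 e'.1.2 e'.2.2 hp hp'
    exact Prod.ext (Subtype.ext h1) (Subtype.ext h2)
  have hcov : frontier (convexHull ℝ (F : Set (EuclideanSpace ℝ (Fin 2)))) ⊆
      (F : Set (EuclideanSpace ℝ (Fin 2))) ∪
        ⋃ e ∈ s, segment ℝ (e.1 : EuclideanSpace ℝ (Fin 2)) e.2 := by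
    intro z hz
    rcases frontier_convexHull_subset_edges hint hz with h | ⟨a, ha, b, hb, hab, hzab⟩
    · exact Or.inl h
    · refine Or.inr (Set.mem_iUnion₂.2 ⟨(⟨a, ha⟩, ⟨b, hb⟩), ?_, hzab⟩)
      exact Finset.mem_filter.2 ⟨Finset.mem_univ _, hab⟩
  have hF0 : μH[1] (F : Set (EuclideanSpace ℝ (Fin 2))) = 0 := by
    have := Measure.nullSingletonClass_hausdorff (EuclideanSpace ℝ (Fin 2)) (d := 1) one_pos
    exact F.finite_toSet.measure_zero _
  calc _ ≤ μH[1] (F : Set (EuclideanSpace ℝ (Fin 2))) +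
        ∑ e ∈ s, μH[1] (segment ℝ (e.1 : EuclideanSpace ℝ (Fin 2)) e.2) :=
      (measure_mono hcov).trans ((measure_union_le _ _).trans
        (add_le_add le_rfl (measure_biUnion_finset_le _ _)))
    _ = ∑ e ∈ s, edist (e.1 : EuclideanSpace ℝ (Fin 2)) e.2 := by
      simp [hF0, hausdorffMeasure_segment]
    _ ≤ 2 * μH[1] K :=
      sum_dist_le_two_mul_hausdorffMeasure (fun x : F => (x : EuclideanSpace ℝ (Fin 2))) hK hKm
        (fun x => hFK x x.2) s hs

/-! ### Degenerate hulls, approximation by polygons, and the conclusion -/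

theorem IsPreconnected.convex_of_collinear {E : Type*} [NormedAddCommGroup E]
    [InnerProductSpace ℝ E] {K : Set E} (hK : IsPreconnected K) (hcol : Collinear ℝ K) :
    Convex ℝ K := by
  obtain ⟨p, v, hv⟩ := (collinear_iff_exists_forall_eq_smul_vadd (k := ℝ) K).1 hcol
  intro a ha b hb s t hs ht hst
  obtain ⟨α, hα⟩ := hv a ha
  obtain ⟨β, hβ⟩ := hv b hb
  have hz : s • a + t • b = (s * α + t * β) • v + p := by
    obtain rfl : t = 1 - s := by linarith
    rw [hα, hβ, vadd_eq_add, vadd_eq_add]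
    module
  have himg : (fun x => inner ℝ v x) '' K |>.OrdConnected :=
    (hK.image _ (by fun_prop)).ordConnected
  have hmem : inner ℝ v (s • a + t • b) ∈ (fun x => inner ℝ v x) '' K := by
    rw [inner_add_right, inner_smul_right, inner_smul_right]
    exact himg.convex (Set.mem_image_of_mem _ ha) (Set.mem_image_of_mem _ hb) hs ht hst
  obtain ⟨k, hk, hkz⟩ := hmem
  obtain ⟨γ, hγ⟩ := hv k hk
  suffices k = s • a + t • b from this ▸ hk
  have h0 : (γ - (s * α + t * β)) * inner ℝ v v = 0 := by
    simp only [hz] at hkz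
    rw [hγ, vadd_eq_add, inner_add_right, inner_add_right, inner_smul_right,
      inner_smul_right] at hkz
    linarith
  rw [hz, hγ, vadd_eq_add]
  rcases mul_eq_zero.1 h0 with h | h
  · rw [sub_eq_zero.1 h]
  · rw [inner_self_eq_zero.1 h]; simp

theorem collinear_of_interior_convexHull_eq_empty {K : Set (EuclideanSpace ℝ (Fin 2))}
    (h : ¬ (interior (convexHull ℝ K)).Nonempty) : Collinear ℝ K := by
  rw [interior_convexHull_nonempty_iff_affineSpan_eq_top] at h
  rcases K.eq_empty_or_nonempty with rfl | hne
  · exact collinear_empty ℝ _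
  rw [collinear_iff_finrank_le_one]
  have hlt : vectorSpan ℝ K < ⊤ := by
    refine lt_top_iff_ne_top.2 fun h' => h ?_
    rw [AffineSubspace.affineSpan_eq_top_iff_vectorSpan_eq_top_of_nonempty ℝ _ _ hne]
    exact h'
  have := Submodule.finrank_lt_finrank_of_lt hlt
  rw [finrank_top, finrank_euclideanSpace_fin] at this
  omega

/-- A compact set spanning the space is contained in dilations with ratio arbitrarily close to one
of the convex hull of finitely many of its points. -/
theorem IsCompact.exists_finset_subset_homothety {E : Type*} [NormedAddCommGroup E]
    [NormedSpace ℝ E] [FiniteDimensional ℝ E] {K : Set E} (hK : IsCompact K)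
    (hint : (interior (convexHull ℝ K)).Nonempty) {η : ℝ} (hη : 1 < η) :
    ∃ F : Finset E, (∀ x ∈ F, x ∈ K) ∧ (interior (convexHull ℝ (F : Set E))).Nonempty ∧
      ∃ z, K ⊆ AffineMap.homothety z η '' convexHull ℝ (F : Set E) := by
  classical
  rw [interior_convexHull_nonempty_iff_affineSpan_eq_top] at hint
  obtain ⟨t, htK, hspan, hind⟩ := exists_affineIndependent ℝ E K
  have htfin : t.Finite := finite_set_of_fin_dim_affineIndependent ℝ hind
  obtain ⟨z, hz⟩ := interior_convexHull_nonempty_iff_affineSpan_eq_top.2 (hspan.trans hint)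
  obtain ⟨ρ, hρ, hball⟩ := Metric.isOpen_iff.1 isOpen_interior z hz
  -- With this mesh, the error `x - f` divided by `η - 1` stays in the ball about `z` inside the
  -- simplex spanned by `t`.
  have hε : 0 < (η - 1) * ρ := mul_pos (sub_pos.2 hη) hρ
  obtain ⟨N, hNK, hNfin, hcov⟩ := hK.finite_cover_balls hε
  have hF : (↑(htfin.toFinset ∪ hNfin.toFinset) : Set E) = t ∪ N := by simp
  refine ⟨htfin.toFinset ∪ hNfin.toFinset, fun x hx => ?_, ?_, z, fun x hx => ?_⟩
  · rw [← Finset.mem_coe, hF] at hx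
    exact hx.elim (fun h => htK h) fun h => hNK h
  · rw [hF]
    exact ⟨z, interior_mono (convexHull_mono Set.subset_union_left) hz⟩
  · rw [hF]
    obtain ⟨f, hf, hxf⟩ := Set.mem_iUnion₂.1 (hcov hx)
    rw [Metric.mem_ball, dist_eq_norm] at hxf
    have hη1 : η - 1 ≠ 0 := (sub_pos.2 hη).ne'
    have hη0 : η ≠ 0 := by positivity
    have hw : z + (η - 1)⁻¹ • (x - f) ∈ convexHull ℝ (t ∪ N) := by
      refine convexHull_mono Set.subset_union_left (interior_subset (hball ?_))
      rw [Metric.mem_ball, dist_eq_norm, add_sub_cancel_left, norm_smul, norm_inv,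
        Real.norm_of_nonneg (sub_pos.2 hη).le, inv_mul_lt_iff₀ (sub_pos.2 hη)]
      exact hxf
    have hf' : f ∈ convexHull ℝ (t ∪ N) := subset_convexHull ℝ _ (Or.inr hf)
    refine ⟨η⁻¹ • f + (1 - η⁻¹) • (z + (η - 1)⁻¹ • (x - f)),
      convex_convexHull ℝ _ hf' hw (by positivity)
        (sub_nonneg.2 (inv_le_one_of_one_le₀ hη.le)) (by ring), ?_⟩
    rw [AffineMap.homothety_apply, vsub_eq_sub, vadd_eq_add]
    match_scalars <;> field_simp <;> ring

theorem frontier_homothety_image_subset {E : Type*} [NormedAddCommGroup E] [NormedSpace ℝ E]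
    {P : Set E} (hP : IsCompact P) (z : E) {η : ℝ} (hη : η ≠ 0) :
    frontier (AffineMap.homothety z η '' P) ⊆ AffineMap.homothety z η '' frontier P := by
  intro q hq
  have hcl : IsClosed (AffineMap.homothety z η '' P) :=
    (hP.image (AffineMap.homothety_continuous z η)).isClosed
  rw [hcl.frontier_eq] at hq
  obtain ⟨⟨p, hp, rfl⟩, hint⟩ := hq
  refine ⟨p, ?_, rfl⟩
  rw [hP.isClosed.frontier_eq]
  refine ⟨hp, fun hpi => hint ?_⟩
  exact interior_maximal (Set.image_mono interior_subset)
    (AffineMap.homothety_isOpenMap z η hη _ isOpen_interior) (Set.mem_image_of_mem _ hpi)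

theorem proposition2p9 (K : Set (EuclideanSpace ℝ (Fin 2)))
    (hK_compact : IsCompact K) (hK_connected : IsPreconnected K)
    (hK_finite : μH[1] K < ⊤) :
    μH[1] (frontier (convexHull ℝ K)) ≤ 2 * μH[1] K := by
  by_cases hint : (interior (convexHull ℝ K)).Nonempty
  · have key : ∀ η : ℝ, 1 < η →
        μH[1] (frontier (convexHull ℝ K)) ≤ ENNReal.ofReal η * (2 * μH[1] K) := by
      intro η hη
      have hη0 : 0 < η := by linarith
      obtain ⟨F, hFK, hFint, z, hKQ⟩ := hK_compact.exists_finset_subset_homothety hint hη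
      have hP := F.finite_toSet.isCompact_convexHull ℝ
      have hQconv : Convex ℝ (AffineMap.homothety z η ''
          convexHull ℝ (F : Set (EuclideanSpace ℝ (Fin 2)))) :=
        (convex_convexHull ℝ _).affine_image _
      calc μH[1] (frontier (convexHull ℝ K))
          ≤ μH[1] (frontier (AffineMap.homothety z η ''
              convexHull ℝ (F : Set (EuclideanSpace ℝ (Fin 2))))) :=
            (convex_convexHull ℝ K).hausdorffMeasure_frontier_le hint (convexHull_min hKQ hQconv)
              (hP.image (AffineMap.homothety_continuous z η)) zero_le_one
        _ ≤ μH[1] (AffineMap.homothety z η ''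
              frontier (convexHull ℝ (F : Set (EuclideanSpace ℝ (Fin 2))))) :=
            measure_mono (frontier_homothety_image_subset hP z hη0.ne')
        _ = ENNReal.ofReal η *
              μH[1] (frontier (convexHull ℝ (F : Set (EuclideanSpace ℝ (Fin 2))))) := by
            rw [hausdorffMeasure_homothety_image zero_le_one z hη0.ne', NNReal.rpow_one,
              ENNReal.smul_def, smul_eq_mul, ← enorm_eq_nnnorm, Real.enorm_eq_ofReal hη0.le]
        _ ≤ _ := by
            gcongr
            exact hausdorffMeasure_frontier_convexHull_finset_le hK_connected
              hK_compact.measurableSet F hFK hFint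
    have hlim : Filter.Tendsto (fun η : ℝ => ENNReal.ofReal η * (2 * μH[1] K))
        (nhdsWithin 1 (Set.Ioi 1)) (nhds (ENNReal.ofReal 1 * (2 * μH[1] K))) :=
      ENNReal.Tendsto.mul_const
        ((ENNReal.continuous_ofReal.tendsto 1).mono_left nhdsWithin_le_nhds) (Or.inl (by simp))
    rw [ENNReal.ofReal_one, one_mul] at hlim
    exact ge_of_tendsto hlim (eventually_nhdsWithin_of_forall key)
  · have hconv := hK_connected.convex_of_collinear (collinear_of_interior_convexHull_eq_empty hint)
    rw [hconv.convexHull_eq]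
    calc μH[1] (frontier K) ≤ μH[1] K :=
          measure_mono (frontier_subset_closure.trans hK_compact.isClosed.closure_eq.subset)
      _ ≤ 2 * μH[1] K := le_mul_of_one_le_left' one_le_two
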